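/- Let $n,d,l$ be positive integers with $\gcd(l,nd)=d$, and regard $\mathrm{GF}(2^d)$ as a subfield of $\mathrm{GF}(2^{nd})$. Define polynomials over $\mathrm{GF}(2^{nd})$ by $C_1(x)=C_2(x)=1$ and $$C_{i+2}(x)=C_{i+1}(x)+x^{2^{il}}C_i(x)\quad(i\ge 1),$$ and let $Z_1(x)=1$ and $Z_n(x)=C_{n+1}(x)+x\,C_{n-1}(x)^{2^l}$ for $n>1$. Then: 1. The number of distinct zeros of $Z_n$ in $\mathrm{GF}(2^{nd})$ equals $\dfrac{2^{(n+1)d}-2^{2d}}{2^{2d}-1}$ if $n$ is odd, and $\dfrac{2^{(n+1)d}-2^{d}}{2^{2d}-1}$ if $n$ is even. 2. Every zero of $Z_n$ in $\mathrm{GF}(2^{nd})$ has multiplicity one and is of the form $$V=\frac{v^{2^{2l}+1}}{(v+v^{2^l})^{2^l+1}}\quad\text{for some } v\in\mathrm{GF}(2^{nd})\setminus\mathrm{GF}(2^d).$$ 3. $Z_n$ splits into linear factors over $\mathrm{GF}(2^{nd})$ if and only if $d=l$ or $n=1$. -/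

import Mathlib

open Polynomial

namespace HK

/-- The polynomials `C_i(x)`: `C_1 = C_2 = 1` and `C_{i+2} = C_{i+1} + x^{2^{il}} C_i` for `i ≥ 1`.
The value at index `0` is never used. -/
noncomputable def polyC (K : Type*) [Field K] (l : ℕ) : ℕ → K[X]
  | 0 => 0
  | 1 => 1
  | 2 => 1
  | (i + 3) => polyC K l (i + 2) + X ^ (2 ^ ((i + 1) * l)) * polyC K l (i + 1)

/-- The polynomials `Z_n(x)`: `Z_1 = 1` and `Z_n = C_{n+1} + x C_{n-1}^{2^l}` for `n > 1`.
The value at index `0` is never used. -/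
noncomputable def polyZ (K : Type*) [Field K] (l : ℕ) : ℕ → K[X]
  | 0 => 0
  | 1 => 1
  | (m + 2) => polyC K l (m + 3) + X * polyC K l (m + 1) ^ (2 ^ l)

/-- The element `V = v_0^{2^{2l}+1} / (v_0 + v_1)^{2^l+1}`, where `v_0 = v` and `v_1 = v^{2^l}`. -/
def elemV {K : Type*} [Field K] (l : ℕ) (v : K) : K :=
  v ^ (2 ^ (2 * l) + 1) / (v + v ^ (2 ^ l)) ^ (2 ^ l + 1)

end HK

/-! Let `σ` be the `2 ^ l`-th power map. It has order `n` and fixed field `F`, of size `q = 2 ^ d`;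
write `N` for the norm `x · σ x ⋯ σ ^ (n - 1) x`. The recurrence `u_{i+2} = u_{i+1} + σ ^ i (a) u_i`
has a transfer matrix over `n` steps with trace `Z_n(a)` and determinant `N(a)`. If `x σ(x) + x =
a`, then `Z_n(a) = N(x) + N(x + 1)` (`seqZ_eq_add`). So `Z_n(a) = 0` means that `(x + 1) / x` has
norm one, and Hilbert 90 gives `x = w / (w + σ w)`, whence `a = V(w)`. That such an `x` exists in
`K` for every zero `a` is `exists_root_of_seqZ_eq_zero`.

For the count, the fibre of `V` through `v` has `q - 1` elements for each root of `x σ(x) + x =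
V(v)`. There are `q + 1` roots if `v` lies in the image of `g ↦ g + σ g`, and one otherwise. This
image has `|K| / q` elements; it contains `F` for even `n` and meets `F` only in `0` for odd `n`.

The derivative of `Z_n` is a power of `C_{n-1}`, so a multiple zero would make two consecutive `C_i`
vanish. Hence zeros are simple, and splitting means that the number of zeros equals the degree.
These are the same function `degC` at `2 ^ d` and at `2 ^ l`, strictly increasing in the base when
`n ≥ 2`. -/

namespace HK

/-! ### Cyclic groups of automorphisms: resolvents, norms, Hilbert 90 -/

section Twisted

variable {K : Type*} [Field K]

lemma pow_succ_apply (σ : RingAut K) (i : ℕ) (x : K) : (σ ^ (i + 1)) x = σ ((σ ^ i) x) := by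
  rw [pow_succ']; rfl

lemma pow_succ_apply' (σ : RingAut K) (i : ℕ) (x : K) : (σ ^ (i + 1)) x = (σ ^ i) (σ x) := by
  rw [pow_succ]; rfl

/-- Applying `σ` shifts the index cyclically, so a twisted recurrence for `T` becomes an equation
for the sum. -/
lemma apply_sum_inv_pow (σ : RingAut K) {n : ℕ} (hσ : σ ^ n = 1) (T : ℕ → K) (hT : T n = T 0) :
    σ (∑ i ∈ Finset.range n, (σ⁻¹ ^ i) (T i)) = ∑ i ∈ Finset.range n, (σ⁻¹ ^ i) (T (i + 1)) := by
  have hG : ∀ i, σ ((σ⁻¹ ^ (i + 1)) (T (i + 1))) = (σ⁻¹ ^ i) (T (i + 1)) := fun i => by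
    rw [pow_succ_apply]; exact σ.apply_symm_apply _
  have h1 := Finset.sum_range_succ (fun i => σ ((σ⁻¹ ^ i) (T i))) n
  rw [Finset.sum_range_succ'] at h1
  have hn : σ⁻¹ ^ n = 1 := by rw [inv_pow, hσ, inv_one]
  simp only [hG, hn, hT, pow_zero, add_left_inj] at h1
  rw [map_sum, h1]

/-- Dedekind's independence of characters, applied to the distinct powers of `σ⁻¹`. -/
lemma exists_sum_inv_pow_ne_zero (σ : RingAut K) {n : ℕ} (hσ : orderOf σ = n) (u : ℕ → K) {j : ℕ}
    (hj : j < n) (hu : u j ≠ 0) : ∃ z, ∑ i ∈ Finset.range n, (σ⁻¹ ^ i) (u i * z) ≠ 0 := by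
  by_contra! h
  have hinj : Function.Injective
      (fun i : Fin n => (((σ⁻¹ ^ (i : ℕ) : RingAut K) : K →+* K) : K →* K)) := by
    intro i k hik
    have : (σ⁻¹ ^ (i : ℕ) : RingAut K) = σ⁻¹ ^ (k : ℕ) := by
      ext x
      exact DFunLike.congr_fun hik x
    have := pow_injOn_Iio_orderOf (x := σ⁻¹) (by simp [hσ]) (by simp [hσ]) this
    exact Fin.ext this
  have hli := (linearIndependent_monoidHom K K).comp _ hinj
  rw [Fintype.linearIndependent_iff] at hli
  have := hli (fun i => (σ⁻¹ ^ (i : ℕ)) (u i)) (by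
    ext z
    have := h z
    rw [Finset.sum_range] at this
    simpa [Finset.sum_apply] using this) ⟨j, hj⟩
  exact hu (by simpa using this)

/-- The product `x · σ x ⋯ σ ^ (i - 1) x`. -/
def partialNorm (σ : RingAut K) (x : K) (i : ℕ) : K := ∏ j ∈ Finset.range i, (σ ^ j) x

@[simp] lemma partialNorm_zero (σ : RingAut K) (x : K) : partialNorm σ x 0 = 1 := by
  simp [partialNorm]

lemma partialNorm_succ (σ : RingAut K) (x : K) (i : ℕ) :
    partialNorm σ x (i + 1) = partialNorm σ x i * (σ ^ i) x := by
  simp [partialNorm, Finset.prod_range_succ]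

lemma partialNorm_succ' (σ : RingAut K) (x : K) (i : ℕ) :
    partialNorm σ x (i + 1) = x * σ (partialNorm σ x i) := by
  rw [partialNorm, Finset.prod_range_succ', partialNorm, map_prod, mul_comm]
  simp [pow_succ_apply]

lemma partialNorm_mul (σ : RingAut K) (x y : K) (i : ℕ) :
    partialNorm σ (x * y) i = partialNorm σ x i * partialNorm σ y i := by
  simp [partialNorm, Finset.prod_mul_distrib]

lemma partialNorm_one (σ : RingAut K) (i : ℕ) : partialNorm σ 1 i = 1 := by
  simp [partialNorm]

lemma partialNorm_ne_zero (σ : RingAut K) {x : K} (hx : x ≠ 0) (i : ℕ) : partialNorm σ x i ≠ 0 :=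
  Finset.prod_ne_zero_iff.2 fun j _ => (map_ne_zero_iff _ (σ ^ j).injective).2 hx

lemma partialNorm_eq_zero (σ : RingAut K) {n : ℕ} (hn : 0 < n) : partialNorm σ 0 n = 0 := by
  obtain ⟨m, rfl⟩ := Nat.exists_eq_add_of_lt hn
  simp [partialNorm_succ]

lemma apply_partialNorm (σ : RingAut K) {n : ℕ} (hσ : σ ^ n = 1) (x : K) :
    σ (partialNorm σ x n) = partialNorm σ x n := by
  by_cases hx : x = 0
  · rcases Nat.eq_zero_or_pos n with rfl | hn
    · simp
    · simp [hx, partialNorm_eq_zero σ hn]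
  · apply mul_left_cancel₀ hx
    rw [← partialNorm_succ', partialNorm_succ, hσ, mul_comm]
    rfl

/-- Hilbert's Theorem 90 for a cyclic group of automorphisms. -/
lemma exists_apply_eq_mul (σ : RingAut K) {n : ℕ} (hn : 0 < n) (hσ : orderOf σ = n) {t : K}
    (ht : partialNorm σ t n = 1) : ∃ v, v ≠ 0 ∧ σ v = t * v := by
  obtain ⟨z, hz⟩ := exists_sum_inv_pow_ne_zero σ hσ (fun i => partialNorm σ t i) hn (by simp)
  refine ⟨_, hz, ?_⟩
  rw [apply_sum_inv_pow σ (hσ ▸ pow_orderOf_eq_one σ) (fun i => partialNorm σ t i * z)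
    (by simp [ht]), Finset.mul_sum]
  refine Finset.sum_congr rfl fun i _ => ?_
  have : (σ⁻¹ ^ i) ((σ ^ i) t) = t := by
    rw [inv_pow]; exact (σ ^ i).symm_apply_apply t
  rw [partialNorm_succ, mul_right_comm, map_mul, this, mul_comm]

/-- Compare the norm with `ψ x = σ x / x` on `Kˣ`. Hilbert 90 gives `ker N ≤ im ψ`, so counting
gives `|im N| ≥ |ker ψ|`; as `im N ≤ ker ψ`, they are equal. -/
lemma exists_partialNorm_eq [Finite K] (σ : RingAut K) {n : ℕ} (hn : 0 < n) (hσ : orderOf σ = n)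
    {s : K} (hs : s ≠ 0) (hfix : σ s = s) : ∃ c, c ≠ 0 ∧ partialNorm σ c n = s := by
  have hσn : σ ^ n = 1 := hσ ▸ pow_orderOf_eq_one σ
  let N : Kˣ →* K :=
    { toFun := fun x => partialNorm σ x n
      map_one' := partialNorm_one σ n
      map_mul' := fun x y => by simp [partialNorm_mul] }
  let N' : Kˣ →* Kˣ := N.toHomUnits
  have hN' : ∀ x, (N' x : K) = partialNorm σ x n := fun x => rfl
  let S : Kˣ →* Kˣ := Units.map (σ : K →* K)
  let ψ : Kˣ →* Kˣ := S / MonoidHom.id _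
  have hψ : ∀ x, ψ x = S x / x := fun x => rfl
  have hS : ∀ x, (S x : K) = σ x := fun x => rfl
  have hker : ∀ x, x ∈ ψ.ker ↔ σ x = x := fun x => by
    rw [MonoidHom.mem_ker, hψ, div_eq_one, Units.ext_iff, hS]
  have h1 : N'.ker ≤ ψ.range := fun t ht => by
    rw [MonoidHom.mem_ker, Units.ext_iff, hN'] at ht
    obtain ⟨v, hv, h⟩ := exists_apply_eq_mul σ hn hσ ht
    refine ⟨Units.mk0 v hv, ?_⟩
    rw [hψ, div_eq_iff_eq_mul, Units.ext_iff, hS]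
    simpa using h
  have h2 : N'.range ≤ ψ.ker := by
    rintro _ ⟨x, rfl⟩
    rw [hker, hN', apply_partialNorm σ hσn]
  have c1 := Subgroup.card_le_of_le h1
  have e1 := N'.ker.card_mul_index
  have e2 := ψ.ker.card_mul_index
  rw [Subgroup.index_ker] at e1 e2
  have hle : Nat.card ψ.ker ≤ Nat.card N'.range := by
    by_contra! hlt
    have : 0 < Nat.card ψ.range := Nat.card_pos
    nlinarith
  have heq : N'.range = ψ.ker := Subgroup.eq_of_le_of_card_ge h2 hle
  have : Units.mk0 s hs ∈ N'.range := by
    rw [heq, hker]; exact hfix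
  obtain ⟨c, hc⟩ := this
  exact ⟨c, c.ne_zero, by rw [← hN', hc]; rfl⟩

end Twisted

/-! ### The recurrence for `C_i` and the equation `x σ(x) + x = a` -/

section Recurrence

variable {K : Type*} [Field K]

/-- The values `C_i(a)`, for an automorphism `σ` in place of the `2 ^ l`-th power map. -/
def seqC (σ : RingAut K) (a : K) : ℕ → K
  | 0 => 0
  | 1 => 1
  | i + 2 => seqC σ a (i + 1) + (σ ^ i) a * seqC σ a i

@[simp] lemma seqC_zero (σ : RingAut K) (a : K) : seqC σ a 0 = 0 := rfl

@[simp] lemma seqC_one (σ : RingAut K) (a : K) : seqC σ a 1 = 1 := rfl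

lemma seqC_add_two (σ : RingAut K) (a : K) (i : ℕ) :
    seqC σ a (i + 2) = seqC σ a (i + 1) + (σ ^ i) a * seqC σ a i := rfl

/-- The value `Z_{m+1}(a)`. -/
def seqZ (σ : RingAut K) (a : K) (m : ℕ) : K := seqC σ a (m + 2) + a * σ (seqC σ a m)

/-- The recurrence unrolled from its other end, as for continuants. -/
lemma seqC_add_two' (σ : RingAut K) (a : K) (i : ℕ) :
    seqC σ a (i + 2) = σ (seqC σ a (i + 1)) + σ a * σ (σ (seqC σ a i)) := by
  induction i using Nat.twoStepInduction with
  | zero => simp [seqC_add_two]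
  | one => simp [seqC_add_two]
  | more i h1 h2 =>
    have e1 := congrArg σ (seqC_add_two σ a (i + 1))
    have e2 := congrArg (fun y => σ (σ y)) (seqC_add_two σ a i)
    simp only [map_add, map_mul, ← pow_succ_apply] at e1 e2
    rw [seqC_add_two]
    linear_combination h2 + (σ ^ (i + 2)) a * h1 - e1 - σ a * e2

section CharTwo

variable {σ : RingAut K} {a x : K}

/-- Since `σ ^ i (a) = σ ^ i (x) · σ ^ (i + 1) (x + 1)`, each step multiplies the left side by `σ ^
(i + 1) (x + 1)`. -/
lemma seqC_succ_add (h : x * σ x + x = a) (i : ℕ) :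
    seqC σ a (i + 1) + (σ ^ i) x * seqC σ a i = σ (partialNorm σ (x + 1) i) := by
  induction i with
  | zero => simp
  | succ i ih =>
    have ha : (σ ^ i) a = (σ ^ i) x * (σ ^ (i + 1)) x + (σ ^ i) x := by
      rw [← h, map_add, map_mul, pow_succ_apply']
    rw [partialNorm_succ, map_mul, ← ih, seqC_add_two, ha, ← pow_succ_apply, map_add, map_one]
    ring

lemma seqC_ne_zero_or {a : K} (ha : a ≠ 0) (i : ℕ) :
    seqC σ a i ≠ 0 ∨ seqC σ a (i + 1) ≠ 0 := by
  induction i with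
  | zero => simp
  | succ i ih =>
    by_contra! ⟨h, h'⟩
    rw [seqC_add_two, h, zero_add] at h'
    have : (σ ^ i) a ≠ 0 := (map_ne_zero_iff _ (σ ^ i).injective).2 ha
    exact mul_ne_zero this (ih.resolve_right (by simp [h])) h'

variable [CharP K 2]

/-- The Casoratian of the solutions `C_j` and `σ (C_{j-1})` of one recurrence; signs disappear in
characteristic two. -/
lemma seqC_det (σ : RingAut K) (a : K) (i : ℕ) :
    seqC σ a (i + 1) * σ (seqC σ a (i + 1)) + seqC σ a (i + 2) * σ (seqC σ a i) =
      σ (partialNorm σ a i) := by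
  induction i with
  | zero => simp
  | succ i ih =>
    rw [partialNorm_succ, map_mul, ← ih, seqC_add_two σ a (i + 1), ← pow_succ_apply]
    nth_rw 2 [seqC_add_two σ a i]
    simp only [map_add, map_mul, ← pow_succ_apply]
    linear_combination (seqC σ a (i + 2) * σ (seqC σ a (i + 1))) * CharTwo.two_eq_zero (R := K)

variable {σ : RingAut K} {a x : K}

/-- In characteristic two the partial norms of `x` solve the same recurrence as the left side, with
the same first two terms. -/
lemma seqC_succ_mul (h : x * σ x + x = a) (i : ℕ) :
    seqC σ a (i + 1) * x + a * σ (seqC σ a i) = partialNorm σ x (i + 1) := by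
  induction i using Nat.twoStepInduction with
  | zero => simp [partialNorm_succ]
  | one =>
    simp only [partialNorm_succ, seqC_add_two, ← h]
    simp
    linear_combination x * CharTwo.two_eq_zero (R := K)
  | more i h1 h2 =>
    have ha : (σ ^ (i + 1)) a = (σ ^ (i + 1)) x * (σ ^ (i + 2)) x + (σ ^ (i + 1)) x := by
      rw [← h, map_add, map_mul, pow_succ_apply' σ (i + 1)]
    have e := congrArg σ (seqC_add_two σ a i)
    rw [map_add, map_mul, ← pow_succ_apply] at e
    rw [partialNorm_succ, partialNorm_succ, seqC_add_two σ a (i + 1)]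
    rw [partialNorm_succ] at h2
    linear_combination h2 + (σ ^ (i + 1)) a * h1 + partialNorm σ x (i + 1) * ha + a * e +
      partialNorm σ x (i + 1) * (σ ^ (i + 1)) x * CharTwo.two_eq_zero (R := K)

lemma seqZ_eq_add {m : ℕ} (hσ : σ ^ (m + 1) = 1) (h : x * σ x + x = a) :
    seqZ σ a m = partialNorm σ x (m + 1) + partialNorm σ (x + 1) (m + 1) := by
  have h1 := seqC_succ_add h (m + 1)
  have h2 := seqC_succ_mul h m
  rw [apply_partialNorm σ hσ, hσ, RingAut.one_apply] at h1
  rw [← h1, ← h2, seqZ]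
  linear_combination (-(seqC σ a (m + 1) * x)) * CharTwo.two_eq_zero (R := K)

variable [Finite K]

/-- With trace zero the transfer matrix has the double eigenvalue `s`, where `s ^ 2 = N(a)`. Either
`C_n(a) ≠ 0` and the eigenvector is explicit, or the matrix is the scalar `s` and an averaging
argument is needed. -/
lemma exists_root_of_seqZ_eq_zero {m : ℕ} (hσ : orderOf σ = m + 1) (ha : a ≠ 0)
    (hZ : seqZ σ a m = 0) : ∃ x, x * σ x + x = a := by
  have two : (2 : K) = 0 := CharTwo.two_eq_zero
  have hσn : σ ^ (m + 1) = 1 := hσ ▸ pow_orderOf_eq_one σ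
  obtain ⟨s, hs⟩ : ∃ s, partialNorm σ a (m + 1) = s * s :=
    FiniteField.isSquare_of_char_two (ringChar.eq K 2) _
  have hs0 : s ≠ 0 := by
    rintro rfl
    exact partialNorm_ne_zero σ ha (m + 1) (by simpa using hs)
  have hsσ : σ s = s := by
    have := apply_partialNorm σ hσn a
    rw [hs, map_mul] at this
    have h : (σ s + s) * (σ s + s) = 0 := by linear_combination this + (s * s + s * σ s) * two
    have h' := mul_self_eq_zero.1 h
    linear_combination h' - s * two
  set k := seqC σ a (m + 1) with hk
  set r := a * σ (seqC σ a m) with hr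
  have hp : seqC σ a (m + 2) = r := by
    rw [seqZ, ← hr] at hZ
    linear_combination hZ - r * two
  have hdet : r * r + a * k * σ k = s * s := by
    have := seqC_det σ a m
    rw [hp] at this
    rw [← hs, partialNorm_succ', ← this, ← hk]
    ring_nf
    rw [hr]; ring
  have hσr : σ k + σ r = r := by
    rw [hr, map_mul, hk, ← seqC_add_two', hp]
  by_cases hk0 : k = 0
  -- Dividing `C_i` by the partial norms of some `c` of norm `s` makes the sequence periodic. Its
  -- twisted average `y` satisfies the second-order equation `e3`, and `x = c σ(y) / y` is the
  -- required root.
  · obtain ⟨c, hc0, hc⟩ := exists_partialNorm_eq σ (Nat.succ_pos m) hσ hs0 hsσ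
    have hrs : r = s := by
      have h : (r + s) * (r + s) = 0 := by
        rw [hk0] at hdet
        linear_combination hdet + (s * s + r * s) * two
      linear_combination (mul_self_eq_zero.1 h) - s * two
    have hm : 1 < m + 1 := by
      rcases Nat.eq_zero_or_pos m with rfl | h
      · simp [hk] at hk0
      · omega
    obtain ⟨z, hz⟩ := exists_sum_inv_pow_ne_zero σ hσ
      (fun i => seqC σ a i / partialNorm σ c i) hm (by simp [partialNorm_succ, hc0])
    set T : ℕ → K := fun i => seqC σ a i / partialNorm σ c i * z with hT
    have hT0 : T (m + 1) = T 0 := by simp [hT, ← hk, hk0]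
    have hT1 : T (m + 1 + 1) = T (0 + 1) := by
      simp only [hT, partialNorm_succ σ c (m + 1), hp, hrs, hc, hσn]
      simp only [seqC_one, pow_zero, zero_add, partialNorm_succ, partialNorm_zero]
      simp only [RingAut.one_apply]
      field_simp
    have e1 := apply_sum_inv_pow σ hσn T hT0
    have e2 := apply_sum_inv_pow σ hσn (fun i => T (i + 1)) hT1
    rw [← e1] at e2
    set y := ∑ i ∈ Finset.range (m + 1), (σ⁻¹ ^ i) (T i) with hy
    have inv : ∀ i x, (σ⁻¹ ^ i) ((σ ^ i) x) = x := fun i x => by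
      rw [inv_pow]; exact (σ ^ i).symm_apply_apply x
    have e3 : c * σ c * σ (σ y) = c * σ y + a * y := by
      rw [e2, e1, hy, Finset.mul_sum, Finset.mul_sum, Finset.mul_sum, ← Finset.sum_add_distrib]
      refine Finset.sum_congr rfl fun i _ => ?_
      have hc' : ∀ i, (σ ^ i) c ≠ 0 := fun i => (map_ne_zero_iff _ (σ ^ i).injective).2 hc0
      have : (σ ^ i) c * (σ ^ (i + 1)) c * T (i + 2) = (σ ^ i) c * T (i + 1) + (σ ^ i) a * T i := by
        simp only [hT, partialNorm_succ, seqC_add_two]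
        have := hc' i
        have := hc' (i + 1)
        have := partialNorm_ne_zero σ hc0 i
        field_simp
      have := congrArg (σ⁻¹ ^ i) this
      simpa only [map_add, map_mul, inv, pow_succ_apply'] using this
    have hy1 : σ y ≠ 0 := (map_ne_zero_iff _ σ.injective).2 hz
    refine ⟨c * σ y / y, ?_⟩
    rw [map_div₀, map_mul]
    field_simp
    linear_combination e3 + (c * σ y) * two
  · have hk1 : σ k ≠ 0 := (map_ne_zero_iff _ σ.injective).2 hk0
    -- Any root has `N(x) = N(x + 1) = s`, so `seqC_succ_mul` reads `k x + r = s` and forces this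
    -- value.
    refine ⟨(r + s) / k, ?_⟩
    rw [map_div₀, map_add, hsσ]
    field_simp
    linear_combination hdet + (r + s) * hσr + (r * s + s * s - a * k * σ k) * two
end CharTwo
end Recurrence

/-! ### The map `V` and its fibres -/

section Fibres

variable {K : Type*} [Field K]

/-- The element `V`, for an automorphism `σ` in place of the `2 ^ l`-th power map. -/
def crossV (σ : RingAut K) (v : K) : K := v * σ (σ v) / ((v + σ v) * (σ v + σ (σ v)))

variable [CharP K 2] {σ : RingAut K} {v : K}

lemma add_apply_ne_zero (hv : σ v ≠ v) : v + σ v ≠ 0 := fun h =>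
  hv (CharTwo.add_eq_zero.1 h).symm

lemma apply_add_apply_ne_zero (hv : σ v ≠ v) : σ v + σ (σ v) ≠ 0 :=
  add_apply_ne_zero fun h => hv (σ.injective h)

omit [CharP K 2] in
lemma ne_zero_of_apply_ne (hv : σ v ≠ v) : v ≠ 0 := by
  rintro rfl
  simp at hv

lemma crossV_ne_zero (hv : σ v ≠ v) : crossV σ v ≠ 0 := by
  have h0 := ne_zero_of_apply_ne hv
  have h1 : σ (σ v) ≠ 0 := by simpa using h0
  exact div_ne_zero (mul_ne_zero h0 h1)
    (mul_ne_zero (add_apply_ne_zero hv) (apply_add_apply_ne_zero hv))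

lemma root_div_add (hv : σ v ≠ v) :
    v / (v + σ v) * σ (v / (v + σ v)) + v / (v + σ v) = crossV σ v := by
  have h1 := add_apply_ne_zero hv
  have h2 := apply_add_apply_ne_zero hv
  rw [crossV, map_div₀, map_add]
  field_simp
  linear_combination v * σ v * CharTwo.two_eq_zero (R := K)

lemma seqZ_crossV {m : ℕ} (hσ : σ ^ (m + 1) = 1) (hv : σ v ≠ v) : seqZ σ (crossV σ v) m = 0 := by
  have h1 := add_apply_ne_zero hv
  have h0 := ne_zero_of_apply_ne hv
  rw [seqZ_eq_add hσ (root_div_add hv)]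
  have h : v / (v + σ v) + 1 = σ v / (v + σ v) := by
    field_simp
    linear_combination v * CharTwo.two_eq_zero (R := K)
  have h2 : partialNorm σ (σ v) (m + 1) = partialNorm σ v (m + 1) := by
    rw [← apply_partialNorm σ hσ v, partialNorm, partialNorm, map_prod]
    exact Finset.prod_congr rfl fun i _ => by rw [← pow_succ_apply, pow_succ_apply']
  rw [h, div_eq_mul_inv, div_eq_mul_inv, partialNorm_mul, partialNorm_mul, h2]
  exact CharTwo.add_self_eq_zero _

lemma exists_root_eq_div_add {m : ℕ} (hσ : orderOf σ = m + 1) {a x : K} (ha : a ≠ 0)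
    (hZ : seqZ σ a m = 0) (hx : x * σ x + x = a) : ∃ w, σ w ≠ w ∧ x = w / (w + σ w) := by
  have two : (2 : K) = 0 := CharTwo.two_eq_zero
  have hσn : σ ^ (m + 1) = 1 := hσ ▸ pow_orderOf_eq_one σ
  have hx0 : x ≠ 0 := by
    rintro rfl
    simp at hx
    exact ha hx.symm
  rw [seqZ_eq_add hσn hx, CharTwo.add_eq_zero] at hZ
  have hN : partialNorm σ ((x + 1) * x⁻¹) (m + 1) = 1 := by
    rw [partialNorm_mul, ← hZ, ← partialNorm_mul, mul_inv_cancel₀ hx0, partialNorm_one]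
  obtain ⟨w, hw0, hw⟩ := exists_apply_eq_mul σ (Nat.succ_pos m) hσ hN
  have hw1 : x * σ w = (x + 1) * w := by
    rw [hw]
    field_simp
  have hw2 : σ w ≠ w := by
    intro h
    rw [h] at hw1
    exact hw0 (by linear_combination -hw1)
  refine ⟨w, hw2, ?_⟩
  rw [eq_div_iff (add_apply_ne_zero hw2)]
  linear_combination hw1 + x * w * two

lemma seqZ_eq_zero_iff [Finite K] {m : ℕ} (hσ : orderOf σ = m + 1) {a : K} (ha : a ≠ 0) :
    seqZ σ a m = 0 ↔ ∃ v, σ v ≠ v ∧ a = crossV σ v := by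
  refine ⟨fun hZ => ?_, ?_⟩
  · obtain ⟨x, hx⟩ := exists_root_of_seqZ_eq_zero hσ ha hZ
    obtain ⟨v, hv, rfl⟩ := exists_root_eq_div_add hσ ha hZ hx
    exact ⟨v, hv, by rw [← hx, root_div_add hv]⟩
  · rintro ⟨v, hv, rfl⟩
    exact seqZ_crossV (hσ ▸ pow_orderOf_eq_one σ) hv

/-! ### Fibre sizes and the number of zeros -/

section Counting

variable [Fintype K] [DecidableEq K]

variable (σ) in
/-- The elements fixed by `σ`. -/
def fixedPts : Finset K := Finset.univ.filter fun x => σ x = x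

omit [CharP K 2] in
@[simp] lemma mem_fixedPts {x : K} : x ∈ fixedPts σ ↔ σ x = x := by simp [fixedPts]

omit [CharP K 2] in
lemma card_filter_apply_eq_mul {t w : K} (hw : w ≠ 0) (h : σ w = t * w) :
    (Finset.univ.filter fun v : K => v ≠ 0 ∧ σ v = t * v).card + 1 = (fixedPts σ).card := by
  have h0 : (0 : K) ∈ fixedPts σ := by simp
  rw [← Finset.card_erase_add_one h0, add_left_inj]
  have hσw : σ w ≠ 0 := by simpa using hw
  refine Finset.card_bij' (fun v _ => v / w) (fun c _ => c * w) ?_ ?_ ?_ ?_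
  · intro v hv
    simp only [Finset.mem_filter, Finset.mem_univ, true_and] at hv
    have ht : t ≠ 0 := by rintro rfl; simp [hw] at h
    simp [hv.1, hw, hv.2, h, mul_div_mul_left, ht]
  · intro c hc
    simp only [Finset.mem_erase, mem_fixedPts] at hc
    simp [hc.1, hw, hc.2, h, mul_left_comm]
  · intro v hv
    field_simp
  · intro c hc
    field_simp

lemma card_filter_add_apply_eq {u g : K} (h : g + σ g = u) :
    (Finset.univ.filter fun g : K => g + σ g = u).card = (fixedPts σ).card := by
  have two : (2 : K) = 0 := CharTwo.two_eq_zero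
  refine Finset.card_bij' (fun v _ => v + g) (fun c _ => c + g) ?_ ?_ ?_ ?_
  · intro v hv
    simp only [Finset.mem_filter, Finset.mem_univ, true_and] at hv
    simp only [mem_fixedPts, map_add]
    linear_combination hv - h + (σ g - v) * two
  · intro c hc
    simp only [mem_fixedPts] at hc
    simp only [Finset.mem_filter, Finset.mem_univ, true_and, map_add]
    linear_combination hc + h + c * two
  · intro v hv
    linear_combination g * two
  · intro c hc
    linear_combination g * two

/-- The roots of `x σ(x) + x = V` other than `v / (v + σ v)`. -/
lemma card_roots_erase (hv : σ v ≠ v) :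
    ((Finset.univ.filter fun x : K => x * σ x + x = crossV σ v).erase (v / (v + σ v))).card =
      (Finset.univ.filter fun g : K => g + σ g = σ v).card := by
  have two : (2 : K) = 0 := CharTwo.two_eq_zero
  have h0 := ne_zero_of_apply_ne hv
  have h01 : σ v ≠ 0 := by simpa using h0
  have h02 : σ (σ v) ≠ 0 := by simpa using h0
  have h1 := add_apply_ne_zero hv
  have h2 := apply_add_apply_ne_zero hv
  symm
  -- Write `x = x₀ (1 + y)` with `x₀` the known root. Cancelling that root leaves an equation linear
  -- in `1 / y`, which becomes `g + σ g = σ v` for `g = σ v / y`.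
  refine Finset.card_bij (fun g _ => v / (v + σ v) * (1 + σ v / g)) ?_ ?_ ?_
  · intro g hg
    simp only [Finset.mem_filter, Finset.mem_univ, true_and] at hg
    have hg0 : g ≠ 0 := by
      rintro rfl
      simp at hg
      exact h01 hg.symm
    have hg1 : σ g ≠ 0 := by simpa using hg0
    have hg' : σ g + σ (σ g) = σ (σ v) := by rw [← hg, map_add]
    simp only [Finset.mem_erase, Finset.mem_filter, Finset.mem_univ, true_and]
    refine ⟨?_, ?_⟩
    · simp [h0, h1, hg0]
    · rw [crossV]
      simp only [map_mul, map_div₀, map_add, map_one]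
      field_simp
      generalize σ (σ v) = c
      rw [← hg]
      linear_combination (g * ((g + σ g) * (σ g + c) + (g + σ g + c) * σ g) +
        σ g * (g * σ g + σ g * σ g + c * σ g)) * two
  · intro g hg g' hg' h
    simp only [Finset.mem_filter, Finset.mem_univ, true_and] at hg hg'
    have := mul_left_cancel₀ (div_ne_zero h0 h1) h
    simpa [div_eq_mul_inv, h0] using this
  · intro x hx
    simp only [Finset.mem_erase, Finset.mem_filter, Finset.mem_univ, true_and] at hx
    obtain ⟨hx, hr⟩ := hx
    obtain ⟨y, rfl⟩ : ∃ y, x = v / (v + σ v) * (1 + y) :=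
      ⟨x * (v + σ v) / v + 1, by field_simp; linear_combination (-v) * two⟩
    have hy : y ≠ 0 := by
      rintro rfl
      simp at hx
    have hy1 : σ y ≠ 0 := by simpa using hy
    rw [crossV] at hr
    simp only [map_mul, map_div₀, map_add, map_one] at hr
    refine ⟨σ v / y, ?_, by field_simp⟩
    simp only [Finset.mem_filter, Finset.mem_univ, true_and, map_div₀]
    field_simp at hr ⊢
    linear_combination hr - (σ v * (1 + y) + σ v * y * σ y) * two

lemma card_roots_crossV (hv : σ v ≠ v) :
    (Finset.univ.filter fun x : K => x * σ x + x = crossV σ v).card =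
      if ∃ g, g + σ g = v then (fixedPts σ).card + 1 else 1 := by
  rw [← Finset.card_erase_add_one (a := v / (v + σ v)) (by simpa using root_div_add hv),
    card_roots_erase hv]
  split_ifs with h
  · obtain ⟨g, hg⟩ := h
    rw [card_filter_add_apply_eq (g := σ g) (by rw [← hg, map_add])]
  · rw [add_eq_right, Finset.card_eq_zero, Finset.filter_eq_empty_iff]
    intro g _ hg
    refine h ⟨σ.symm g, σ.injective ?_⟩
    rw [map_add, RingEquiv.apply_symm_apply, hg]

/-- Sort the fibre by `x = w / (w + σ w)`: this value determines `σ w / w`, hence `w` up to a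
nonzero fixed factor. -/
lemma card_crossV_fibre {m : ℕ} (hσ : orderOf σ = m + 1) (hv : σ v ≠ v) :
    (Finset.univ.filter fun w : K => σ w ≠ w ∧ crossV σ w = crossV σ v).card =
      (Finset.univ.filter fun x : K => x * σ x + x = crossV σ v).card *
        ((fixedPts σ).card - 1) := by
  have hσn : σ ^ (m + 1) = 1 := hσ ▸ pow_orderOf_eq_one σ
  rw [Finset.card_eq_sum_card_fiberwise (f := fun w => w / (w + σ w))
    (t := Finset.univ.filter fun x : K => x * σ x + x = crossV σ v), Finset.sum_const_nat]
  · intro x hx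
    simp only [Finset.mem_filter, Finset.mem_univ, true_and] at hx
    obtain ⟨w, hw, rfl⟩ := exists_root_eq_div_add hσ (crossV_ne_zero hv) (seqZ_crossV hσn hv) hx
    have hw0 := ne_zero_of_apply_ne hw
    have hw1 := add_apply_ne_zero hw
    rw [← card_filter_apply_eq_mul (t := σ w / w) hw0 (by field_simp), Nat.add_sub_cancel,
      Finset.filter_filter]
    congr 1
    ext u
    simp only [Finset.mem_filter, Finset.mem_univ, true_and]
    constructor
    · rintro ⟨⟨hu, -⟩, hx'⟩
      refine ⟨ne_zero_of_apply_ne hu, ?_⟩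
      have := add_apply_ne_zero hu
      rw [div_eq_div_iff this hw1] at hx'
      field_simp
      linear_combination -hx'
    · rintro ⟨hu0, hu⟩
      have hu' : σ u * w = σ w * u := by
        rw [hu]
        field_simp
      have hu1 : σ u ≠ u := by
        intro h
        rw [h, mul_comm] at hu'
        exact hw (mul_right_cancel₀ hu0 hu').symm
      have hx' : u / (u + σ u) = w / (w + σ w) := by
        rw [div_eq_div_iff (add_apply_ne_zero hu1) hw1]
        linear_combination -hu'
      refine ⟨⟨hu1, ?_⟩, hx'⟩
      rw [← root_div_add hu1, hx', hx]
  · intro w hw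
    simp only [Finset.coe_filter, Finset.mem_univ, true_and, Set.mem_ofPred_eq] at hw ⊢
    rw [root_div_add hw.1, hw.2]

omit [CharP K 2] [Fintype K] [DecidableEq K] in
lemma seqC_zero_right (i : ℕ) : seqC σ 0 (i + 1) = 1 := by
  induction i with
  | zero => simp
  | succ i ih => simp [seqC_add_two, ih]

omit [CharP K 2] [Fintype K] [DecidableEq K] in
lemma seqZ_zero_right (m : ℕ) : seqZ σ 0 m = 1 := by
  simp [seqZ, seqC_zero_right]

/-- Weight each non-fixed `v` by the inverse size of its fibre, so that every zero receives total
weight one. -/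
lemma card_seqZ_zeros {m : ℕ} (hσ : orderOf σ = m + 1) (hq : 1 < (fixedPts σ).card) :
    ((Finset.univ.filter fun a : K => seqZ σ a m = 0).card : ℚ) =
      (Finset.univ.filter fun v : K => σ v ≠ v ∧ ∃ g, g + σ g = v).card /
          (((fixedPts σ).card : ℚ) ^ 2 - 1) +
        (Finset.univ.filter fun v : K => σ v ≠ v ∧ ¬ ∃ g, g + σ g = v).card /
          (((fixedPts σ).card : ℚ) - 1) := by
  have hq1 : (1 : ℚ) < ((fixedPts σ).card : ℚ) := by exact_mod_cast hq
  set q : ℚ := ((fixedPts σ).card : ℚ)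
  have hq2 : q - 1 ≠ 0 := by linarith
  have hq3 : q + 1 ≠ 0 := by linarith
  set A := Finset.univ.filter fun v : K => σ v ≠ v with hA
  have hcast : (((fixedPts σ).card - 1 : ℕ) : ℚ) = q - 1 := by
    rw [Nat.cast_sub hq.le, Nat.cast_one]
  have hfib : ∀ v ∈ A, ((A.filter fun w => crossV σ w = crossV σ v).card : ℚ) =
      if ∃ g, g + σ g = v then q ^ 2 - 1 else q - 1 := by
    intro v hv
    have hv' : σ v ≠ v := by simpa [hA] using hv
    rw [hA, Finset.filter_filter, card_crossV_fibre hσ hv', card_roots_crossV hv', Nat.cast_mul,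
      hcast]
    split_ifs
    · push_cast
      ring
    · simp
  have hmaps : ∀ v ∈ A, crossV σ v ∈ Finset.univ.filter fun a : K => seqZ σ a m = 0 := by
    intro v hv
    simpa using seqZ_crossV (hσ ▸ pow_orderOf_eq_one σ) (by simpa [hA] using hv)
  have hsum : ((Finset.univ.filter fun a : K => seqZ σ a m = 0).card : ℚ) =
      ∑ v ∈ A, if ∃ g, g + σ g = v then 1 / (q ^ 2 - 1) else 1 / (q - 1) := by
    rw [← Finset.sum_fiberwise_of_maps_to hmaps, Finset.card_eq_sum_ones, Nat.cast_sum]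
    refine Finset.sum_congr rfl fun a ha => ?_
    have ha' : seqZ σ a m = 0 := by simpa using ha
    have ha0 : a ≠ 0 := by
      rintro rfl
      simp [seqZ_zero_right] at ha'
    obtain ⟨v, hv, rfl⟩ := (seqZ_eq_zero_iff hσ ha0).1 ha'
    have hvA : v ∈ A := by simpa [hA] using hv
    have hcard := hfib v hvA
    have hne : ((A.filter fun w => crossV σ w = crossV σ v).card : ℚ) ≠ 0 := by
      rw [Nat.cast_ne_zero]
      exact Finset.card_ne_zero_of_mem (Finset.mem_filter.2 ⟨hvA, rfl⟩)
    rw [Finset.sum_congr rfl (g := fun _ =>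
      1 / ((A.filter fun w => crossV σ w = crossV σ v).card : ℚ))]
    · rw [Finset.sum_const, nsmul_eq_mul, mul_one_div_cancel hne, Nat.cast_one]
    · intro w hw
      rw [Finset.mem_filter] at hw
      have := hfib w hw.1
      rw [hw.2] at this
      rw [this]
      split_ifs <;> rfl
  rw [hsum, Finset.sum_ite, Finset.sum_const, Finset.sum_const, hA, Finset.filter_filter,
    Finset.filter_filter, nsmul_eq_mul, nsmul_eq_mul, mul_one_div, mul_one_div]

end Counting
end Fibres

/-! ### The image of `g ↦ g + σ g` and the parity of `n` -/

section Image

variable {K : Type*} [Field K] [CharP K 2] {σ : RingAut K} [Fintype K] [DecidableEq K]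

lemma card_image_mul : (Finset.univ.filter fun v : K => ∃ g, g + σ g = v).card *
    (fixedPts σ).card = Fintype.card K := by
  rw [← Finset.card_univ, Finset.card_eq_sum_card_fiberwise (s := Finset.univ) (f := fun g : K => g + σ g)
    (t := Finset.univ.filter fun v : K => ∃ g, g + σ g = v), Finset.sum_const_nat]
  · intro v hv
    simp only [Finset.mem_filter, Finset.mem_univ, true_and] at hv
    obtain ⟨g, hg⟩ := hv
    exact card_filter_add_apply_eq hg
  · intro g _
    simp

omit [Fintype K] [DecidableEq K] in
lemma exists_add_apply_eq_of_even {n : ℕ} (hn : Even n) (hn0 : 0 < n) (hσ : orderOf σ = n) {v : K}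
    (hv : σ v = v) : ∃ g, g + σ g = v := by
  have hσn : σ ^ n = 1 := hσ ▸ pow_orderOf_eq_one σ
  obtain ⟨z, hz⟩ := exists_sum_inv_pow_ne_zero σ hσ (fun _ => 1) hn0 one_ne_zero
  simp only [one_mul] at hz
  have e1 := apply_sum_inv_pow σ hσn (fun _ => z) rfl
  -- Evenness of `n` makes the coefficients `i` periodic in `K`. Then `σ g = g + θ`, with `θ` a
  -- nonzero fixed trace.
  have e2 := apply_sum_inv_pow σ hσn (fun i => (i : K) * z) (by
    simp [(CharP.cast_eq_zero_iff K 2 n).2 hn.two_dvd])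
  set θ := ∑ i ∈ Finset.range n, (σ⁻¹ ^ i) z
  set g := ∑ i ∈ Finset.range n, (σ⁻¹ ^ i) ((i : K) * z)
  have e3 : σ g = g + θ := by
    rw [e2, ← Finset.sum_add_distrib]
    refine Finset.sum_congr rfl fun i _ => ?_
    rw [← map_add]
    congr 1
    push_cast
    ring
  refine ⟨v / θ * g, ?_⟩
  rw [map_mul, map_div₀, hv, e1, e3]
  field_simp
  linear_combination (v * g) * CharTwo.two_eq_zero (R := K)

omit [Fintype K] [DecidableEq K] in
-- Each application of `σ` adds `v` to `g`; after `n` of them `g` returns, so `n v = 0` with `n`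
-- odd.
lemma eq_zero_of_add_apply_eq_of_odd {n : ℕ} (hn : Odd n) (hσ : σ ^ n = 1) {v g : K}
    (hv : σ v = v) (h : g + σ g = v) : v = 0 := by
  have hs : σ g = g + v := by
    rw [← h, ← add_assoc, CharTwo.add_self_eq_zero, zero_add]
  have hi : ∀ i : ℕ, (σ ^ i) g = g + i * v := fun i => by
    induction i with
    | zero => simp
    | succ i ih =>
      rw [pow_succ_apply, ih, map_add, map_mul, map_natCast, hv, hs]
      push_cast
      ring
  have := hi n
  rw [hσ, RingAut.one_apply, left_eq_add, CharTwo.natCast_eq_ite,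
    if_neg (Nat.not_even_iff_odd.2 hn), one_mul] at this
  exact this

lemma card_image_sub_fixedPts_of_even {n : ℕ} (hn : Even n) (hn0 : 0 < n) (hσ : orderOf σ = n) :
    (Finset.univ.filter fun v : K => σ v ≠ v ∧ ∃ g, g + σ g = v).card + (fixedPts σ).card =
      (Finset.univ.filter fun v : K => ∃ g, g + σ g = v).card := by
  rw [add_comm, ← Finset.card_filter_add_card_filter_not
    (s := Finset.univ.filter fun v : K => ∃ g, g + σ g = v) (fun v => σ v = v),
    Finset.filter_filter, Finset.filter_filter]
  congr 2 <;> ext v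
  · simp only [mem_fixedPts, Finset.mem_filter, Finset.mem_univ, true_and]
    exact ⟨fun h => ⟨exists_add_apply_eq_of_even hn hn0 hσ h, h⟩, And.right⟩
  · simp [and_comm]

lemma card_image_sub_fixedPts_of_odd {n : ℕ} (hn : Odd n) (hσ : σ ^ n = 1) :
    (Finset.univ.filter fun v : K => σ v ≠ v ∧ ∃ g, g + σ g = v).card + 1 =
      (Finset.univ.filter fun v : K => ∃ g, g + σ g = v).card := by
  rw [add_comm, ← Finset.card_filter_add_card_filter_not
    (s := Finset.univ.filter fun v : K => ∃ g, g + σ g = v) (fun v => σ v = v),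
    Finset.filter_filter, Finset.filter_filter, ← Finset.card_singleton (0 : K)]
  congr 2 <;> ext v
  · simp only [Finset.mem_singleton, Finset.mem_filter, Finset.mem_univ, true_and]
    constructor
    · rintro rfl
      exact ⟨⟨0, by simp⟩, by simp⟩
    · rintro ⟨⟨g, hg⟩, hv⟩
      exact eq_zero_of_add_apply_eq_of_odd hn hσ hv hg
  · simp [and_comm]

omit [CharP K 2] in
lemma card_not_fixed : (Finset.univ.filter fun v : K => σ v ≠ v ∧ ∃ g, g + σ g = v).card +
    (Finset.univ.filter fun v : K => σ v ≠ v ∧ ¬ ∃ g, g + σ g = v).card + (fixedPts σ).card =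
      Fintype.card K := by
  rw [← Finset.filter_filter, ← Finset.filter_filter, Finset.card_filter_add_card_filter_not,
    add_comm, fixedPts, Finset.card_filter_add_card_filter_not, Finset.card_univ]

lemma card_seqZ_zeros_of_even {m : ℕ} (hn : Even (m + 1)) (hσ : orderOf σ = m + 1)
    (hq : 1 < (fixedPts σ).card) :
    ((Finset.univ.filter fun a : K => seqZ σ a m = 0).card : ℚ) =
      (((fixedPts σ).card : ℚ) * (Fintype.card K : ℚ) - ((fixedPts σ).card : ℚ)) /
        (((fixedPts σ).card : ℚ) ^ 2 - 1) := by
  have h1 := card_image_mul (σ := σ)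
  have h2 := card_image_sub_fixedPts_of_even hn (Nat.succ_pos m) hσ
  have h3 := card_not_fixed (σ := σ)
  rw [card_seqZ_zeros hσ hq]
  rw [← h2] at h1
  qify at h1 h3 hq
  generalize ((fixedPts σ).card : ℚ) = q at *
  have hq2 : q - 1 ≠ 0 := by linarith
  have hq3 : q + 1 ≠ 0 := by linarith
  rw [show q ^ 2 - 1 = (q - 1) * (q + 1) by ring]
  field_simp
  linear_combination (q + 1) * h3 - h1

lemma card_seqZ_zeros_of_odd {m : ℕ} (hn : Odd (m + 1)) (hσ : orderOf σ = m + 1)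
    (hq : 1 < (fixedPts σ).card) :
    ((Finset.univ.filter fun a : K => seqZ σ a m = 0).card : ℚ) =
      (((fixedPts σ).card : ℚ) * (Fintype.card K : ℚ) - ((fixedPts σ).card : ℚ) ^ 2) /
        (((fixedPts σ).card : ℚ) ^ 2 - 1) := by
  have h1 := card_image_mul (σ := σ)
  have h2 := card_image_sub_fixedPts_of_odd hn (hσ ▸ pow_orderOf_eq_one σ)
  have h3 := card_not_fixed (σ := σ)
  rw [card_seqZ_zeros hσ hq]
  rw [← h2] at h1
  qify at h1 h3 hq
  generalize ((fixedPts σ).card : ℚ) = q at *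
  have hq2 : q - 1 ≠ 0 := by linarith
  have hq3 : q + 1 ≠ 0 := by linarith
  rw [show q ^ 2 - 1 = (q - 1) * (q + 1) by ring]
  field_simp
  linear_combination (q + 1) * h3 - h1

end Image

/-! ### Order and fixed field of the `2 ^ l`-th power map -/

section Frobenius

variable {K : Type*} [Field K]

lemma pow_natCard_eq_self [Finite K] (x : K) : x ^ Nat.card K = x := by
  have := Fintype.ofFinite K
  rw [Nat.card_eq_fintype_card, FiniteField.pow_card]

lemma pow_two_pow_mul {x : K} {e : ℕ} (h : x ^ 2 ^ e = x) (k : ℕ) : x ^ 2 ^ (e * k) = x := by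
  induction k with
  | zero => simp
  | succ k ih => rw [Nat.mul_succ, pow_add, pow_mul, ih, h]

lemma pow_two_pow_gcd {x : K} {a b : ℕ} (ha : x ^ 2 ^ a = x) (hb : x ^ 2 ^ b = x) :
    x ^ 2 ^ Nat.gcd a b = x := by
  have h : ∀ k, x ^ 2 ^ k = x ↔ Function.IsPeriodicPt (fun y : K => y ^ 2) k x := fun k => by
    rw [Function.IsPeriodicPt, Function.IsFixedPt, pow_iterate]
  rw [h] at *
  exact ha.gcd hb

lemma ncard_pow_two_pow_eq_le {e : ℕ} (he : e ≠ 0) : {x : K | x ^ 2 ^ e = x}.ncard ≤ 2 ^ e := by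
  classical
  have h1 : 1 < 2 ^ e := Nat.one_lt_two_pow he
  have hne := FiniteField.X_pow_card_sub_X_ne_zero K h1
  have hdeg := FiniteField.X_pow_card_sub_X_natDegree_eq K h1
  have hset : {x : K | x ^ 2 ^ e = x} = ((X ^ 2 ^ e - X : K[X]).roots.toFinset : Set K) := by
    ext x
    simp [hne, sub_eq_zero]
  rw [hset, Set.ncard_coe_finset]
  calc _ ≤ Multiset.card (X ^ 2 ^ e - X : K[X]).roots := Multiset.toFinset_card_le _
    _ ≤ _ := card_roots' _
    _ = _ := hdeg

variable [Finite K] [CharP K 2]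

lemma iterateFrobeniusEquiv_eq_pow (l : ℕ) (x : K) :
    iterateFrobeniusEquiv K 2 l x = x ^ 2 ^ l := iterateFrobenius_def 2 l x

lemma iterateFrobeniusEquiv_pow_apply (l i : ℕ) (x : K) :
    ((iterateFrobeniusEquiv K 2 l : RingAut K) ^ i) x = x ^ 2 ^ (i * l) := by
  induction i with
  | zero => simp
  | succ i ih =>
    rw [pow_succ_apply, ih, iterateFrobeniusEquiv_eq_pow, ← pow_mul, ← pow_add]
    congr 2
    ring

lemma iterateFrobeniusEquiv_eq_self_iff {N d l : ℕ} (hd : d ≠ 0) (hgcd : Nat.gcd l N = d)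
    (hK : Nat.card K = 2 ^ N) (F : Subfield K) (hF : Nat.card F = 2 ^ d) (x : K) :
    iterateFrobeniusEquiv K 2 l x = x ↔ x ∈ F := by
  have hN : ∀ x : K, x ^ 2 ^ N = x := fun x => by rw [← hK]; exact pow_natCard_eq_self _
  have hsub : (F : Set K) ⊆ {x | x ^ 2 ^ d = x} := fun x hx => by
    have : (⟨x, hx⟩ : F) ^ 2 ^ d = ⟨x, hx⟩ := by rw [← hF]; exact pow_natCard_eq_self _
    exact congrArg Subtype.val this
  have heq := Set.eq_of_subset_of_ncard_le hsub
    ((ncard_pow_two_pow_eq_le hd).trans_eq (by rw [← hF]; rfl)) (Set.toFinite _)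
  rw [← SetLike.mem_coe, heq, Set.mem_ofPred_eq, iterateFrobeniusEquiv_eq_pow]
  refine ⟨fun h => hgcd ▸ pow_two_pow_gcd h (hN x), fun h => ?_⟩
  obtain ⟨k, rfl⟩ : d ∣ l := hgcd ▸ Nat.gcd_dvd_left l N
  exact pow_two_pow_mul h k

lemma orderOf_iterateFrobeniusEquiv {n d l : ℕ} (hn : 0 < n) (hd : 0 < d)
    (hgcd : Nat.gcd l (n * d) = d) (hK : Nat.card K = 2 ^ (n * d)) :
    orderOf (iterateFrobeniusEquiv K 2 l : RingAut K) = n := by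
  have hN : ∀ x : K, x ^ 2 ^ (n * d) = x := fun x => by rw [← hK]; exact pow_natCard_eq_self _
  obtain ⟨k, rfl⟩ : d ∣ l := hgcd ▸ Nat.gcd_dvd_left l _
  rw [mul_comm n, Nat.gcd_mul_left, Nat.mul_eq_left hd.ne'] at hgcd
  rw [orderOf_eq_iff hn]
  constructor
  · ext x
    rw [iterateFrobeniusEquiv_pow_apply, RingAut.one_apply, ← mul_assoc]
    exact pow_two_pow_mul (hN x) k
  · intro m hm hm0 h
    have h1 : ∀ x : K, x ^ 2 ^ (m * (d * k)) = x := fun x => by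
      rw [← iterateFrobeniusEquiv_pow_apply, h, RingAut.one_apply]
    -- All of `K` satisfies an equation of degree `2 ^ gcd`, so the gcd is at least `n * d`; this
    -- forces `n ∣ m * k` with `k` prime to `n`.
    have h2 : {x : K | x ^ 2 ^ Nat.gcd (n * d) (m * (d * k)) = x} = Set.univ :=
      Set.eq_univ_of_forall fun x => pow_two_pow_gcd (hN x) (h1 x)
    have h0 : 0 < Nat.gcd (n * d) (m * (d * k)) := Nat.gcd_pos_of_pos_left _ (by positivity)
    have h3 := ncard_pow_two_pow_eq_le (K := K) h0.ne'
    rw [h2, Set.ncard_univ, hK, Nat.pow_le_pow_iff_right (by norm_num)] at h3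
    have h4 : n * d ∣ m * (d * k) := by
      have := Nat.gcd_dvd_right (n * d) (m * (d * k))
      rwa [le_antisymm (Nat.le_of_dvd (by positivity) (Nat.gcd_dvd_left _ _)) h3] at this
    rw [show m * (d * k) = m * k * d by ring] at h4
    have h5 : n ∣ m := (Nat.Coprime.symm hgcd).dvd_of_dvd_mul_right
      (Nat.dvd_of_mul_dvd_mul_right hd h4)
    exact absurd (Nat.le_of_dvd hm0 h5) (by omega)

end Frobenius

/-! ### Degrees, derivatives and simple zeros of `Z_n` -/

section Polynomials

variable (K : Type*) [Field K] (l : ℕ)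

lemma polyC_add_two (i : ℕ) :
    polyC K l (i + 2) = polyC K l (i + 1) + X ^ 2 ^ (i * l) * polyC K l i := by
  cases i with
  | zero => simp [polyC]
  | succ i => rfl

lemma eval_zero_polyC (i : ℕ) : (polyC K l (i + 1)).eval 0 = 1 := by
  induction i with
  | zero => simp [polyC]
  | succ i ih => simp [polyC_add_two, ih]

lemma polyC_ne_zero (i : ℕ) : polyC K l (i + 1) ≠ 0 := fun h => by
  simpa [h] using eval_zero_polyC K l i

lemma polyZ_ne_zero (m : ℕ) : polyZ K l (m + 1) ≠ 0 := fun h => by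
  have : (polyZ K l (m + 1)).eval 0 = 1 := by
    cases m with
    | zero => simp [polyZ]
    | succ m => simp [polyZ, eval_zero_polyC]
  simp [h] at this

/-- The degree of `C_{i+1}`, as a function of `t = 2 ^ l`. -/
def degC (t : ℕ) : ℕ → ℕ
  | 0 => 0
  | 1 => 0
  | i + 2 => t ^ (i + 1) + degC t i

lemma degC_lt {t : ℕ} (ht : 2 ≤ t) (i : ℕ) : degC t i < t ^ i := by
  induction i using Nat.twoStepInduction with
  | zero => simp [degC]
  | one => simp [degC]; omega
  | more i h1 _ =>
    have : t ^ i ≤ t ^ (i + 1) := Nat.pow_le_pow_right (by omega) (by omega)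
    rw [degC, pow_succ t (i + 1)]
    nlinarith

lemma degC_mono {s t : ℕ} (h : s ≤ t) (i : ℕ) : degC s i ≤ degC t i := by
  induction i using Nat.twoStepInduction with
  | zero => simp [degC]
  | one => simp [degC]
  | more i h1 _ => exact add_le_add (Nat.pow_le_pow_left h _) h1

lemma degC_strictMono {s t : ℕ} (h : s < t) (i : ℕ) : degC s (i + 2) < degC t (i + 2) :=
  add_lt_add_of_lt_of_le (Nat.pow_lt_pow_left h (by omega)) (degC_mono h.le i)

/-- A geometric sum in closed form; at `t = 2 ^ d` it matches the two zero counts. -/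
lemma degC_mul_of_even_of_odd (t i : ℕ) :
    (Even i → (degC t i : ℚ) * ((t : ℚ) ^ 2 - 1) = t ^ (i + 1) - t) ∧
    (Odd i → (degC t i : ℚ) * ((t : ℚ) ^ 2 - 1) = t ^ (i + 1) - t ^ 2) := by
  induction i using Nat.twoStepInduction with
  | zero => simp [degC]
  | one => simp [degC]
  | more i h1 _ =>
    constructor
    · intro h
      have := h1.1 (by simpa [Nat.even_add] using h)
      rw [degC]
      push_cast
      linear_combination this
    · intro h
      have := h1.2 (by simpa [Nat.odd_add] using h)
      rw [degC]
      push_cast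
      linear_combination this

variable {l} in
lemma natDegree_polyC (hl : l ≠ 0) (i : ℕ) : (polyC K l (i + 1)).natDegree = degC (2 ^ l) i := by
  have h2 : 2 ≤ 2 ^ l := Nat.one_lt_two_pow hl
  induction i using Nat.twoStepInduction with
  | zero => simp [polyC, degC]
  | one => simp [polyC, degC]
  | more i h1 h3 =>
    have e : (X ^ 2 ^ ((i + 1) * l) * polyC K l (i + 1)).natDegree = degC (2 ^ l) (i + 2) := by
      rw [natDegree_mul (pow_ne_zero _ X_ne_zero) (polyC_ne_zero K l i), natDegree_X_pow, h1, degC,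
        ← pow_mul, mul_comm l]
    rw [polyC_add_two, natDegree_add_eq_right_of_natDegree_lt, e]
    rw [e, h3, degC]
    exact (degC_lt h2 _).trans_le (Nat.le_add_right _ _)

variable {l} in
lemma natDegree_polyZ (hl : l ≠ 0) (m : ℕ) :
    (polyZ K l (m + 1)).natDegree = degC (2 ^ l) (m + 1) := by
  have h2 : 2 ≤ 2 ^ l := Nat.one_lt_two_pow hl
  cases m with
  | zero => simp [polyZ, degC]
  | succ m =>
    have h := natDegree_polyC K hl (m + 2)
    rw [polyZ, natDegree_add_eq_left_of_natDegree_lt, h]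
    rw [h]
    refine natDegree_mul_le.trans_lt ?_
    rw [natDegree_X, natDegree_pow, natDegree_polyC K hl, degC, pow_succ]
    have := degC_lt h2 m
    nlinarith

lemma derivative_polyC [CharP K 2] (hl : l ≠ 0) (i : ℕ) : derivative (polyC K l (i + 1)) = 0 := by
  induction i using Nat.twoStepInduction with
  | zero => simp [polyC]
  | one => simp [polyC]
  | more i h1 h2 =>
    have : ((2 : K) ^ ((i + 1) * l)) = 0 := by
      rw [CharTwo.two_eq_zero, zero_pow (by positivity)]
    rw [polyC_add_two, derivative_add, derivative_mul, h1, h2, derivative_X_pow]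
    simp [this]

lemma derivative_polyZ [CharP K 2] (hl : l ≠ 0) (m : ℕ) :
    derivative (polyZ K l (m + 2)) = polyC K l (m + 1) ^ 2 ^ l := by
  rw [polyZ, derivative_add, derivative_mul, derivative_pow, derivative_polyC K l hl,
    derivative_polyC K l hl]
  simp

variable {K l} [Finite K] [CharP K 2]

lemma eval_polyC (a : K) (i : ℕ) :
    (polyC K l i).eval a = seqC (iterateFrobeniusEquiv K 2 l) a i := by
  induction i using Nat.twoStepInduction with
  | zero => simp [polyC]
  | one => simp [polyC]
  | more i h1 h2 =>
    rw [polyC_add_two, seqC_add_two, iterateFrobeniusEquiv_pow_apply]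
    simp [h1, h2]

lemma eval_polyZ (a : K) (m : ℕ) :
    (polyZ K l (m + 1)).eval a = seqZ (iterateFrobeniusEquiv K 2 l) a m := by
  cases m with
  | zero => simp [polyZ, seqZ, seqC_add_two]
  | succ m => simp [polyZ, seqZ, eval_polyC, ← iterateFrobeniusEquiv_eq_pow]

lemma elemV_eq_crossV (v : K) : elemV l v = crossV (iterateFrobeniusEquiv K 2 l) v := by
  have : v ^ 2 ^ (2 * l) = iterateFrobeniusEquiv K 2 l (iterateFrobeniusEquiv K 2 l v) := by
    rw [iterateFrobeniusEquiv_eq_pow, iterateFrobeniusEquiv_eq_pow, ← pow_mul, ← pow_add, two_mul]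
  rw [elemV, crossV, pow_succ, pow_succ, this, ← map_add, ← iterateFrobeniusEquiv_eq_pow l v,
    ← iterateFrobeniusEquiv_eq_pow, mul_comm v, mul_comm (v + _)]

lemma rootMultiplicity_polyZ (hl : l ≠ 0) {m : ℕ} {u : K} (hu : (polyZ K l (m + 1)).IsRoot u) :
    (polyZ K l (m + 1)).rootMultiplicity u = 1 := by
  refine le_antisymm ?_ ((rootMultiplicity_pos (polyZ_ne_zero K l m)).2 hu)
  by_contra! h
  have hd := ((one_lt_rootMultiplicity_iff_isRoot (polyZ_ne_zero K l m)).1 h).2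
  have hu' := hu
  rw [IsRoot, eval_polyZ] at hu'
  cases m with
  | zero => simp [polyZ] at hu
  | succ m =>
    rw [derivative_polyZ K l hl, IsRoot, eval_pow, pow_eq_zero_iff (by positivity), eval_polyC] at hd
    have hu0 : u ≠ 0 := by
      rintro rfl
      simp [seqZ_zero_right] at hu'
    rw [seqZ, seqC_add_two, hd, map_zero, mul_zero, mul_zero, add_zero, add_zero] at hu'
    -- Once `C_{n-1}(u) = 0`, the equation `Z_n(u) = 0` reduces to `C_n(u) = 0`, two consecutive
    -- zeros.
    exact (seqC_ne_zero_or hu0 (m + 1)).elim (· hd) (· hu')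

lemma splits_polyZ_iff (hl : l ≠ 0) (m : ℕ) : (polyZ K l (m + 1)).Splits ↔
    {u : K | (polyZ K l (m + 1)).IsRoot u}.ncard = degC (2 ^ l) (m + 1) := by
  classical
  have hne := polyZ_ne_zero K l m
  have hnodup : (polyZ K l (m + 1)).roots.Nodup := by
    rw [Multiset.nodup_iff_count_le_one]
    intro u
    rw [count_roots]
    by_cases hu : (polyZ K l (m + 1)).IsRoot u
    · exact (rootMultiplicity_polyZ hl hu).le
    · rw [rootMultiplicity_eq_zero hu]
      exact zero_le_one
  have hset : {u : K | (polyZ K l (m + 1)).IsRoot u} =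
      ((polyZ K l (m + 1)).roots.toFinset : Set K) := by
    ext u
    simp [hne]
  rw [splits_iff_card_roots, natDegree_polyZ K hl, hset, Set.ncard_coe_finset,
    Multiset.toFinset_card_of_nodup hnodup]

end Polynomials
end HK

/-! ### The main theorem -/

theorem mainTheorem7
    (n d l : ℕ) (hn : 0 < n) (hd : 0 < d) (hl : 0 < l)
    (hgcd : Nat.gcd l (n * d) = d)
    -- `K` is the field with `2^{nd}` elements and `F` its subfield with `2^d` elements
    (K : Type*) [Field K] [Finite K] (hK : Nat.card K = 2 ^ (n * d))
    (F : Subfield K) (hF : Nat.card F = 2 ^ d) :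
    (Odd n → ({u : K | (HK.polyZ K l n).IsRoot u}.ncard : ℚ)
        = (2 ^ ((n + 1) * d) - 2 ^ (2 * d)) / (2 ^ (2 * d) - 1)) ∧
    (Even n → ({u : K | (HK.polyZ K l n).IsRoot u}.ncard : ℚ)
        = (2 ^ ((n + 1) * d) - 2 ^ d) / (2 ^ (2 * d) - 1)) ∧
    (∀ u : K, (HK.polyZ K l n).IsRoot u →
        (∃ v : K, v ∉ F ∧ u = HK.elemV l v) ∧ (HK.polyZ K l n).rootMultiplicity u = 1) ∧
    ((HK.polyZ K l n).Splits ↔ d = l ∨ n = 1) := by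
  classical
  have := Fintype.ofFinite K
  have hK' : Fintype.card K = 2 ^ (n * d) := by rw [← Nat.card_eq_fintype_card, hK]
  have : Fact (Nat.Prime 2) := ⟨Nat.prime_two⟩
  have : CharP K 2 := charP_of_card_eq_prime_pow hK'
  have hσ := HK.orderOf_iterateFrobeniusEquiv hn hd hgcd hK
  have hfix := HK.iterateFrobeniusEquiv_eq_self_iff hd.ne' hgcd hK F hF
  obtain ⟨m, rfl⟩ : ∃ m, n = m + 1 := ⟨n - 1, by omega⟩
  set σ : RingAut K := iterateFrobeniusEquiv K 2 l with hσdef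
  have hq : (HK.fixedPts σ).card = 2 ^ d := by
    rw [← hF, ← Set.ncard_coe_finset]
    change _ = (F : Set K).ncard
    congr 1
    ext x
    simpa using hfix x
  have hq1 : 1 < (HK.fixedPts σ).card := hq ▸ Nat.one_lt_two_pow hd.ne'
  have hset : {u : K | (HK.polyZ K l (m + 1)).IsRoot u} =
      ((Finset.univ.filter fun a : K => HK.seqZ σ a m = 0 : Finset K) : Set K) := by
    ext u
    simp [IsRoot, HK.eval_polyZ, hσdef]
  have hodd : Odd (m + 1) → ({u : K | (HK.polyZ K l (m + 1)).IsRoot u}.ncard : ℚ)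
      = (2 ^ ((m + 1 + 1) * d) - 2 ^ (2 * d)) / (2 ^ (2 * d) - 1) := by
    intro h
    rw [hset, Set.ncard_coe_finset, HK.card_seqZ_zeros_of_odd h hσ hq1, hq, hK']
    push_cast
    ring
  have heven : Even (m + 1) → ({u : K | (HK.polyZ K l (m + 1)).IsRoot u}.ncard : ℚ)
      = (2 ^ ((m + 1 + 1) * d) - 2 ^ d) / (2 ^ (2 * d) - 1) := by
    intro h
    rw [hset, Set.ncard_coe_finset, HK.card_seqZ_zeros_of_even h hσ hq1, hq, hK']
    push_cast
    ring
  refine ⟨hodd, heven, fun u hu => ⟨?_, HK.rootMultiplicity_polyZ hl.ne' hu⟩, ?_⟩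
  · rw [IsRoot, HK.eval_polyZ] at hu
    have hu0 : u ≠ 0 := by
      rintro rfl
      simp [HK.seqZ_zero_right] at hu
    obtain ⟨v, hv, rfl⟩ := (HK.seqZ_eq_zero_iff hσ hu0).1 hu
    exact ⟨v, fun h => hv ((hfix v).2 h), (HK.elemV_eq_crossV v).symm⟩
  -- The count is the degree formula with `d` in place of `l`, so splitting becomes an equality of
  -- two values of `degC`.
  · have hcard : {u : K | (HK.polyZ K l (m + 1)).IsRoot u}.ncard = HK.degC (2 ^ d) (m + 1) := by
      have h1 : (1 : ℚ) < 2 ^ (2 * d) := one_lt_pow₀ (by norm_num) (by omega)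
      rw [← Nat.cast_inj (R := ℚ)]
      rcases Nat.even_or_odd (m + 1) with h | h
      · rw [heven h, div_eq_iff (by linarith)]
        have := (HK.degC_mul_of_even_of_odd (2 ^ d) (m + 1)).1 h
        push_cast at this
        rw [← pow_mul, ← pow_mul, mul_comm d, mul_comm d] at this
        exact this.symm
      · rw [hodd h, div_eq_iff (by linarith)]
        have := (HK.degC_mul_of_even_of_odd (2 ^ d) (m + 1)).2 h
        push_cast at this
        rw [← pow_mul, ← pow_mul, mul_comm d, mul_comm d] at this
        exact this.symm
    rw [HK.splits_polyZ_iff hl.ne', hcard]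
    constructor
    · intro h
      by_contra! hne
      have hdl : d < l :=
        lt_of_le_of_ne (Nat.le_of_dvd hl (hgcd ▸ Nat.gcd_dvd_left l _)) hne.1
      obtain ⟨k, rfl⟩ : ∃ k, m = k + 1 := ⟨m - 1, by omega⟩
      exact (HK.degC_strictMono (Nat.pow_lt_pow_right (by norm_num) hdl) k).ne h
    · rintro (rfl | h)
      · rfl
      · rw [h]
        rfl
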